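/- Let $\overline{\mathbb Q}$ be an algebraic closure of $\mathbb Q$ and let $K\subset\overline{\mathbb Q}$ be a number field with ring of integers $\mathcal O_K$. Call $K$ *balanced* if for every non-zero $x\in\mathcal O_K$ there is a unit $u\in\mathcal O_K^\times$ such that $|ux|_v\ge 1$ for all Archimedean places $v$ of $K$. For $\beta\in\overline{\mathbb Q}$ let $h(\beta)$ denote the absolute logarithmic Weil height of $\beta$, that is, $$h(\beta)=\frac{1}{[L:\mathbb Q]}\sum_{v}[L_v:\mathbb Q_v]\,\log\max\{1,\|\beta\|_v\},$$ where $L$ is any number field containing $\beta$, $v$ runs over the places of $L$, and $\|\cdot\|_v$ extends the usual absolute value on the completion $\mathbb Q_v$ of $\mathbb Q$ at the place below $v$. Define the Mahler measure of $\beta$ over $K$ by $m_K(\beta)=[K(\beta):K]\cdot h(\beta)$. **Corollary.** Suppose that $K$ is balanced and has class number $1$. Let $\alpha\in K^\times$ and let $\alpha_1,\dots,\alpha_N\in\overline{\mathbb Q}$ be such that $\alpha=\alpha_1\alpha_2\cdots\alpha_N$. Then there exist $\gamma_0,\gamma_1,\dots,\gamma_N\in K$ such that 1. $\alpha=\gamma_0\gamma_1\cdots\gamma_N$;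 2. $\gamma_0$ is a unit of $\mathcal O_K$; 3. $m_K(\gamma_n)\le m_K(\alpha_n)$ for all $1\le n\le N$. -/

import Mathlib

open NumberField IntermediateField

/-- A number field `K` is balanced if every nonzero `x ∈ 𝓞 K` has a unit multiple `u * x`
satisfying `|u * x|_v ≥ 1` at every Archimedean place `v` of `K`. Here `v` is the usual absolute
value coming from a complex embedding; raising it to a positive power (a different normalization
of the place) does not change the condition. -/
def IsBalanced (K : Type*) [Field K] [NumberField K] : Prop :=
  ∀ x : 𝓞 K, x ≠ 0 → ∃ u : (𝓞 K)ˣ, ∀ v : InfinitePlace K, 1 ≤ v ((u : K) * (x : K))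

/-- The (logarithmic) Mahler measure over `K` of an algebraic number `a`:
`m_K(a) = [K(a) : K] * h(a)`, with `h` the absolute logarithmic Weil height. -/
noncomputable def mahlerMeasureOver (K : Type*) {Ω : Type*} [Field K] [Field Ω] [CharZero Ω]
    [Algebra K Ω] (a : Ω) : ℝ :=
  (Module.finrank K K⟮a⟯ : ℝ) * NumberField.absLogHeight₁ a

/-! Each α_n has a primitive minimal polynomial over the principal ideal domain 𝓞 K, with constant
coefficient b_n and leading coefficient c_n. Gauss's lemma and the product formula bound ∏_v
max(|b_n|, |c_n|) by the heights of the conjugates, that is by m_K(α_n)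
(`exists_isIntegral_smul_and_log_prod_max_le`). Both c_n α_n and b_n / α_n are integral, so if α =
A/B in lowest terms, then A ∣ ∏ b_n and B ∣ ∏ c_n. Hence, up to units, A = ∏ s_n and B = ∏ t_n with
s_n ∣ b_n and t_n ∣ c_n. Balancedness rescales s_n and t_n by units until they are no larger than
b_n and c_n at every Archimedean place (`exists_unit_mul_le_of_dvd`). Then γ_n = s_n / t_n has small
enough height, and γ_0 absorbs the units. -/

namespace NumberField

open Height Module

/-! ### Heights under extension of number fields. -/

section Extension

variable {K L : Type*} [Field K] [NumberField K] [Field L] [NumberField L] [Algebra K L]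

/-- The height of a quotient of algebraic integers, up to the norm of the ideal they generate. -/
lemma mulHeight₁_div_mul_absNorm (a b : 𝓞 K) (hb : b ≠ 0) :
    mulHeight₁ ((a : K) / b) * (Ideal.span {a, b}).absNorm =
      ∏ v : InfinitePlace K, max (v a) (v b) ^ v.mult := by
  have hx : (![a, b] : Fin 2 → 𝓞 K) ≠ 0 := fun h ↦ hb (congrFun h 1)
  have hx' : (![(a : K), b] : Fin 2 → K) ≠ 0 := fun h ↦ hb (by simpa using congrFun h 1)
  -- The ideal norm cancels exactly the finite part of the height.
  have h := absNorm_mul_finprod_finitePlace_eq_one hx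
  have hcoe (i : Fin 2) : ((![a, b] i : 𝓞 K) : K) = ![(a : K), b] i := by fin_cases i <;> rfl
  have hr : Set.range ![a, b] = {a, b} := by simp [Set.pair_comm]
  simp only [hcoe, hr] at h
  have hsup (v : InfinitePlace K) : ⨆ i, v (![(a : K), b] i) = max (v a) (v b) := by
    refine le_antisymm (ciSup_le fun i ↦ by fin_cases i <;> simp) (max_le ?_ ?_)
    · exact Finite.le_ciSup_of_le 0 le_rfl
    · exact Finite.le_ciSup_of_le 1 le_rfl
  rw [mulHeight₁_div_eq_mulHeight, mulHeight_eq hx', mul_assoc, mul_comm (finprod _), h, mul_one]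
  simp only [hsup]

lemma prod_infinitePlace_pow_mult_eq_prod_embeddings {M : Type*} [CommMonoid M]
    (g : InfinitePlace K → M) :
    ∏ v : InfinitePlace K, g v ^ v.mult = ∏ φ : K →+* ℂ, g (.mk φ) := by
  classical
  rw [← Finset.prod_fiberwise' _ InfinitePlace.mk g]
  refine Finset.prod_congr rfl fun v _ ↦ ?_
  rw [Finset.prod_const, InfinitePlace.card_filter_mk_eq]

lemma card_embeddings_restrict_eq (φ : K →+* ℂ) [DecidableEq (K →+* ℂ)] :
    (Finset.univ.filter fun ψ : L →+* ℂ ↦ ψ.comp (algebraMap K L) = φ).card = finrank K L := by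
  let := φ.toAlgebra
  have : Module.Finite K L := Module.Finite.of_restrictScalars_finite ℚ K L
  rw [← AlgHom.card K L ℂ, ← Fintype.card_subtype]
  refine Fintype.card_congr ⟨fun ψ ↦ ⟨ψ.1, fun x ↦ RingHom.congr_fun ψ.2 x⟩,
    fun ψ ↦ ⟨ψ, RingHom.ext ψ.commutes⟩, fun _ ↦ rfl, fun _ ↦ rfl⟩

/-- Counted by embeddings, the multiplicities disappear, and each embedding of `K` extends to `L` in
`[L : K]` ways. -/
lemma prod_infinitePlace_comap_pow_mult {M : Type*} [CommMonoid M] (g : InfinitePlace K → M) :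
    ∏ w : InfinitePlace L, g (w.comap (algebraMap K L)) ^ w.mult =
      (∏ v : InfinitePlace K, g v ^ v.mult) ^ finrank K L := by
  classical
  rw [prod_infinitePlace_pow_mult_eq_prod_embeddings g,
    prod_infinitePlace_pow_mult_eq_prod_embeddings fun w : InfinitePlace L ↦
      g (w.comap (algebraMap K L)), ← Finset.prod_pow]
  simp only [InfinitePlace.comap_mk]
  rw [← Finset.prod_fiberwise' _ (fun ψ : L →+* ℂ ↦ ψ.comp (algebraMap K L))
    fun φ ↦ g (InfinitePlace.mk φ)]
  refine Finset.prod_congr rfl fun φ _ ↦ ?_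
  rw [Finset.prod_const]
  exact congrArg _ (card_embeddings_restrict_eq (L := L) φ)

/-- The multiplicative height in an extension of number fields. -/
theorem mulHeight₁_algebraMap (x : K) :
    mulHeight₁ (algebraMap K L x) = mulHeight₁ x ^ finrank K L := by
  obtain ⟨a, b, hb, rfl⟩ := IsFractionRing.div_surjective (A := 𝓞 K) x
  have hb0 : b ≠ 0 := nonZeroDivisors.ne_zero hb
  have hb0' : algebraMap (𝓞 K) (𝓞 L) b ≠ 0 := by
    simpa using hb0
  have hK := mulHeight₁_div_mul_absNorm a b hb0
  have hL := mulHeight₁_div_mul_absNorm (algebraMap (𝓞 K) (𝓞 L) a) (algebraMap (𝓞 K) (𝓞 L) b) hb0'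
  have hspan : Ideal.span {algebraMap (𝓞 K) (𝓞 L) a, algebraMap (𝓞 K) (𝓞 L) b} =
      (Ideal.span {a, b}).map (algebraMap (𝓞 K) (𝓞 L)) := by
    rw [Ideal.map_span, Set.image_pair]
  have hc (y : 𝓞 K) : ((algebraMap (𝓞 K) (𝓞 L) y : 𝓞 L) : L) = algebraMap K L y := rfl
  have hn : (Ideal.span {a, b}).absNorm ≠ 0 := by
    rw [Ne, Ideal.absNorm_eq_zero_iff, Ideal.span_eq_bot]
    simp [hb0]
  have hfr : finrank (𝓞 K) (𝓞 L) = finrank K L :=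
    (IsFractionRing.finrank_eq (𝓞 K) K (𝓞 L) L).symm
  -- The ideal norm and the Archimedean product are both raised to the power `[L : K]`, so finite
  -- places of `L` need not be compared with those of `K`.
  rw [hspan, Ideal.absNorm_algebraMap, hfr] at hL
  have key := prod_infinitePlace_comap_pow_mult (L := L)
    fun v : InfinitePlace K ↦ max (v (a : K)) (v (b : K))
  simp only [InfinitePlace.comap_apply] at key
  simp only [hc] at hL
  rw [key, ← hK, mul_pow, Nat.cast_pow] at hL
  rw [map_div₀]
  exact mul_right_cancel₀ (by positivity) hL

end Extension

/-- The absolute height of `x` computed in a number field containing a conjugate of `x`. -/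
theorem absMulHeight₁_pow_finrank {Ω L : Type*} [Field Ω] [CharZero Ω] [Field L] [NumberField L]
    {x : Ω} (hx : IsIntegral ℚ x) {y : L} (hy : Polynomial.aeval y (minpoly ℚ x) = 0) :
    absMulHeight₁ x ^ finrank ℚ L = mulHeight₁ y := by
  have : FiniteDimensional ℚ ℚ⟮x⟯ := adjoin.finiteDimensional hx
  have : NumberField ℚ⟮x⟯ := {}
  let f : ℚ⟮x⟯ →ₐ[ℚ] L := (algHomAdjoinIntegralEquiv ℚ hx).symm
    ⟨y, (Polynomial.mem_aroots.mpr ⟨minpoly.ne_zero hx, hy⟩)⟩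
  have hf : f (AdjoinSimple.gen ℚ x) = y := algHomAdjoinIntegralEquiv_symm_apply_gen ℚ hx _
  let := f.toRingHom.toAlgebra
  have h := mulHeight₁_algebraMap (L := L) (AdjoinSimple.gen ℚ x)
  rw [show algebraMap ℚ⟮x⟯ L (AdjoinSimple.gen ℚ x) = y from hf] at h
  rw [h, absMulHeight₁, dif_pos hx, ← finrank_mul_finrank ℚ ℚ⟮x⟯ L, pow_mul,
    Real.rpow_inv_natCast_pow (mulHeight₁_nonneg _) finrank_pos.ne']

theorem finrank_mul_absLogHeight₁ {Ω L : Type*} [Field Ω] [CharZero Ω] [Field L] [NumberField L]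
    {x : Ω} (hx : IsIntegral ℚ x) {y : L} (hy : Polynomial.aeval y (minpoly ℚ x) = 0) :
    finrank ℚ L * absLogHeight₁ x = logHeight₁ y := by
  rw [absLogHeight₁, ← Real.log_pow, absMulHeight₁_pow_finrank hx hy, logHeight₁_eq_log_mulHeight₁]

/-! ### Coefficients of a polynomial and heights of its roots. -/

open Polynomial in
lemma FinitePlace.coeff_prod_X_sub_C_le {L : Type*} [Field L] [NumberField L]
    (w : FinitePlace L) (s : Multiset L) (k : ℕ) :
    w ((s.map fun r ↦ X - C r).prod.coeff k) ≤ (s.map fun r ↦ max (w r) 1).prod := by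
  induction s using Multiset.induction generalizing k with
  | empty =>
    simp only [Multiset.map_zero, Multiset.prod_zero, coeff_one]
    split_ifs <;> simp
  | cons r s ih =>
    have hP : 0 ≤ (s.map fun r ↦ max (w r) 1).prod := (apply_nonneg w _).trans (ih 0)
    have h1 : w (r * (s.map fun r ↦ X - C r).prod.coeff k) ≤
        max (w r) 1 * (s.map fun r ↦ max (w r) 1).prod := by
      rw [map_mul]
      exact mul_le_mul (le_max_left _ _) (ih k) (apply_nonneg _ _) (by positivity)
    have hneg (z : L) : w (-z) = w z := w.1.map_neg z
    simp only [Multiset.map_cons, Multiset.prod_cons, sub_mul]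
    rw [coeff_sub, coeff_C_mul, sub_eq_add_neg]
    refine (FinitePlace.add_le w _ _).trans (max_le ?_ ?_)
    · cases k with
      | zero => simpa using hP
      | succ k =>
        rw [coeff_X_mul]
        exact (ih k).trans (le_mul_of_one_le_left hP (le_max_right _ _))
    · rw [hneg]; exact h1

open Polynomial in
-- Otherwise all coefficients would lie in the maximal ideal of `w`.
lemma FinitePlace.exists_coeff_eq_one {L : Type*} [Field L] [NumberField L]
    (w : FinitePlace L) {f : (𝓞 L)[X]} (hf : f.contentIdeal = ⊤) : ∃ k, w (f.coeff k : L) = 1 := by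
  by_contra! h
  refine w.maximalIdeal.isPrime.ne_top (top_le_iff.mp (hf ▸ ?_))
  rw [contentIdeal_def, Ideal.span_le]
  intro c hc
  obtain ⟨k, -, rfl⟩ := mem_coeffs_iff.mp hc
  by_contra hmem
  refine h k ?_
  rw [← norm_embedding_eq w]
  exact (FinitePlace.norm_eq_one_iff_notMem L w.maximalIdeal _).mpr hmem

lemma FinitePlace.hasFiniteMulSupport_max {L : Type*} [Field L] [NumberField L] (x : L) :
    (fun w : FinitePlace L ↦ max (w x) 1).HasFiniteMulSupport := by
  rcases eq_or_ne x 0 with rfl | hx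
  · simp [Function.HasFiniteMulSupport]
  · exact (FinitePlace.hasFiniteMulSupport hx).max Function.hasFiniteMulSupport_fun_one

lemma FinitePlace.hasFiniteMulSupport_multisetProd_max {L : Type*} [Field L] [NumberField L]
    (s : Multiset L) :
    (fun w : FinitePlace L ↦ (s.map fun r ↦ max (w r) 1).prod).HasFiniteMulSupport := by
  induction s using Multiset.induction with
  | empty => simp [Function.HasFiniteMulSupport]
  | cons r s ih =>
    simp only [Multiset.map_cons, Multiset.prod_cons]
    exact (FinitePlace.hasFiniteMulSupport_max r).mul ih

lemma multisetProd_mulHeight₁ {L : Type*} [Field L] [NumberField L] (s : Multiset L) :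
    (s.map mulHeight₁).prod =
      (∏ w : InfinitePlace L, (s.map fun r ↦ max (w r) 1).prod ^ w.mult) *
        ∏ᶠ w : FinitePlace L, (s.map fun r ↦ max (w r) 1).prod := by
  induction s using Multiset.induction with
  | empty => simp
  | cons r s ih =>
    simp only [Multiset.map_cons, Multiset.prod_cons, mul_pow, Finset.prod_mul_distrib]
    rw [ih, mulHeight₁_eq, finprod_mul_distrib (FinitePlace.hasFiniteMulSupport_max r)
      (FinitePlace.hasFiniteMulSupport_multisetProd_max s)]
    ring

open Polynomial in
/-- The easy half of the computation of the product of the heights of the roots of a polynomial. -/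
theorem prod_infinitePlace_max_le_prod_mulHeight₁_roots {L : Type*} [Field L] [NumberField L]
    {f : (𝓞 L)[X]} (hf : f.contentIdeal = ⊤) (hs : (f.map (algebraMap (𝓞 L) L)).Splits) :
    ∏ w : InfinitePlace L, max (w (f.coeff 0 : L)) (w (f.leadingCoeff : L)) ^ w.mult ≤
      ((f.map (algebraMap (𝓞 L) L)).roots.map mulHeight₁).prod := by
  set s := (f.map (algebraMap (𝓞 L) L)).roots with hs'
  have hinj : Function.Injective (algebraMap (𝓞 L) L) := RingOfIntegers.coe_injective
  have hf0 : f ≠ 0 := by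
    rintro rfl
    simp at hf
  set c : L := (f.leadingCoeff : L) with hc
  have hc0 : c ≠ 0 := by simpa [hc] using hf0
  have hprod : f.map (algebraMap (𝓞 L) L) = C c * (s.map fun r ↦ X - C r).prod := by
    conv_lhs => rw [hs.eq_prod_roots]
    rw [leadingCoeff_map_of_injective hinj]
  have hcoeff (k : ℕ) : (f.coeff k : L) = c * (s.map fun r ↦ X - C r).prod.coeff k := by
    rw [← coeff_C_mul, ← hprod, coeff_map]
  have hfin (w : FinitePlace L) : 1 ≤ w c * (s.map fun r ↦ max (w r) 1).prod := by
    obtain ⟨k, hk⟩ := w.exists_coeff_eq_one hf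
    rw [hcoeff, map_mul] at hk
    exact hk.symm.le.trans <| mul_le_mul_of_nonneg_left (w.coeff_prod_X_sub_C_le s k) (apply_nonneg _ _)
  have hinf (w : InfinitePlace L) : max (w (f.coeff 0 : L)) (w c) ≤
      w c * (s.map fun r ↦ max (w r) 1).prod := by
    have h1 : 1 ≤ (s.map fun r ↦ max (w r) 1).prod :=
      Multiset.one_le_prod_map fun _ _ ↦ le_max_right _ _
    refine max_le ?_ (le_mul_of_one_le_right (apply_nonneg _ _) h1)
    rw [hcoeff, map_mul]
    refine mul_le_mul_of_nonneg_left ?_ (apply_nonneg _ _)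
    rw [coeff_zero_multiset_prod, Multiset.map_map, map_multiset_prod, Multiset.map_map]
    refine Multiset.prod_map_le_prod_map₀ _ _ (fun _ _ ↦ apply_nonneg _ _) fun r _ ↦ ?_
    have hneg : w (-r) = w r := w.1.map_neg r
    simp [hneg]
  -- By the product formula the leading coefficient drops out of the product over all places.
  have hpf := prod_abs_eq_one hc0
  have hinfprod : 0 ≤ ∏ w : InfinitePlace L, (w c * (s.map fun r ↦ max (w r) 1).prod) ^ w.mult :=
    Finset.prod_nonneg fun w _ ↦ pow_nonneg (((apply_nonneg w _).trans (le_max_right _ _)).trans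
      (hinf w)) _
  calc
    _ ≤ ∏ w : InfinitePlace L, (w c * (s.map fun r ↦ max (w r) 1).prod) ^ w.mult :=
      Finset.prod_le_prod (fun w _ ↦ pow_nonneg ((apply_nonneg w _).trans (le_max_right _ _)) _)
        fun w _ ↦ pow_le_pow_left₀ ((apply_nonneg w _).trans (le_max_right _ _)) (hinf w) _
    _ ≤ (∏ w : InfinitePlace L, (w c * (s.map fun r ↦ max (w r) 1).prod) ^ w.mult) *
        ∏ᶠ w : FinitePlace L, (w c * (s.map fun r ↦ max (w r) 1).prod) :=
      le_mul_of_one_le_right hinfprod (one_le_finprod hfin)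
    _ = (s.map mulHeight₁).prod := by
      rw [multisetProd_mulHeight₁, finprod_mul_distrib (FinitePlace.hasFiniteMulSupport hc0)
        (FinitePlace.hasFiniteMulSupport_multisetProd_max s)]
      simp only [mul_pow, Finset.prod_mul_distrib]
      rw [mul_mul_mul_comm, hpf, one_mul]

end NumberField

/-! ### Primitive polynomials and divisors of products. -/

open Polynomial in
/-- A nonzero polynomial over the fraction field of a principal ideal domain is proportional to
one with unit content ideal. -/
lemma exists_contentIdeal_eq_top_map_eq_C_mul {R F : Type*} [CommRing R] [IsDomain R]
    [IsPrincipalIdealRing R] [Field F] [Algebra R F] [IsFractionRing R F] {p : F[X]} (hp : p ≠ 0) :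
    ∃ (f : R[X]) (c : F), c ≠ 0 ∧ f.contentIdeal = ⊤ ∧ f.map (algebraMap R F) = C c * p := by
  classical
  let _ : StrongNormalizationMonoid R := UniqueFactorizationMonoid.strongNormalizationMonoid
  let _ : NormalizedGCDMonoid R := UniqueFactorizationMonoid.toNormalizedGCDMonoid R
  obtain ⟨b, hbm, hb⟩ := IsLocalization.integerNormalization_spec (nonZeroDivisors R) p
  set g := IsLocalization.integerNormalization (nonZeroDivisors R) p
  have hinj : Function.Injective (algebraMap R F) := IsFractionRing.injective R F
  have hb0 : algebraMap R F b ≠ 0 := by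
    simpa using nonZeroDivisors.ne_zero hbm
  have hb' : g.map (algebraMap R F) = C (algebraMap R F b) * p := by
    rw [hb, ← algebraMap_smul F b p, smul_eq_C_mul]
  have hg0 : g ≠ 0 := by
    intro h
    rw [h, Polynomial.map_zero, eq_comm, mul_eq_zero, C_eq_zero] at hb'
    exact hb'.elim hb0 hp
  have hcont : algebraMap R F g.content ≠ 0 := by
    simpa [content_eq_zero_iff] using hg0
  refine ⟨g.primPart, (algebraMap R F g.content)⁻¹ * algebraMap R F b,
    mul_ne_zero (inv_ne_zero hcont) hb0,
    (isPrimitive_iff_contentIdeal_eq_top _).mp g.isPrimitive_primPart, ?_⟩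
  have h := hb'
  rw [g.eq_C_content_mul_primPart, Polynomial.map_mul, map_C] at h
  rw [C_mul, mul_assoc, ← h, ← mul_assoc, ← C_mul, inv_mul_cancel₀ hcont, C_1, one_mul]

lemma Finset.exists_unit_mul_prod_eq_of_dvd_prod {ι R : Type*} [CommMonoid R]
    [DecompositionMonoid R] (s : Finset ι) {a : R} {f : ι → R} (h : a ∣ ∏ i ∈ s, f i) :
    ∃ (u : Rˣ) (g : ι → R), a = u * ∏ i ∈ s, g i ∧ ∀ i ∈ s, g i ∣ f i := by
  classical
  induction s using Finset.induction_on generalizing a with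
  | empty =>
    obtain ⟨u, rfl⟩ := isUnit_of_dvd_one (Finset.prod_empty (f := f) ▸ h)
    exact ⟨u, fun _ ↦ 1, by simp, by simp⟩
  | insert i s hi ih =>
    rw [Finset.prod_insert hi] at h
    obtain ⟨d, e, hd, he, rfl⟩ := exists_dvd_and_dvd_of_dvd_mul h
    obtain ⟨u, g, rfl, hg⟩ := ih he
    have hne {j : ι} (hj : j ∈ s) : j ≠ i := fun h ↦ hi (h ▸ hj)
    refine ⟨u, Function.update g i d, ?_, fun j hj ↦ ?_⟩
    · rw [Finset.prod_insert hi, Function.update_self, mul_left_comm]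
      congr 2
      exact Finset.prod_congr rfl fun j hj ↦ (Function.update_of_ne (hne hj) _ _).symm
    · rcases Finset.mem_insert.mp hj with rfl | hj
      · rwa [Function.update_self]
      · rw [Function.update_of_ne (hne hj)]
        exact hg j hj

/-! ### Mahler measure, minimal polynomials and balanced fields. -/

namespace NumberField

open Height Module Polynomial

variable {K Ω : Type*} [Field K] [NumberField K] [Field Ω] [CharZero Ω] [Algebra K Ω]

lemma log_prod_max_le_of_splits {L : Type*} [Field L] [NumberField L] [Algebra K L] {x : Ω}
    (hx : IsIntegral ℚ x) (hL : ((minpoly K x).map (algebraMap K L)).Splits) {f : (𝓞 K)[X]} {c : K}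
    (hc : c ≠ 0) (hf : f.contentIdeal = ⊤)
    (hfm : f.map (algebraMap (𝓞 K) K) = C c * minpoly K x) :
    Real.log (∏ v : InfinitePlace K, max (v (f.coeff 0 : K)) (v (f.leadingCoeff : K)) ^ v.mult) ≤
      finrank ℚ K * mahlerMeasureOver K x := by
  have hxK : IsIntegral K x := hx.tower_top
  have hinj : Function.Injective (algebraMap (𝓞 K) (𝓞 L)) :=
    FaithfulSMul.algebraMap_injective (𝓞 K) (𝓞 L)
  have hf0 : f ≠ 0 := by
    rintro rfl
    simp at hf
  set g := f.map (algebraMap (𝓞 K) (𝓞 L)) with hg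
  have hgm : g.map (algebraMap (𝓞 L) L) =
      C (algebraMap K L c) * (minpoly K x).map (algebraMap K L) := by
    rw [hg, Polynomial.map_map, ← IsScalarTower.algebraMap_eq,
      IsScalarTower.algebraMap_eq (𝓞 K) K L, ← Polynomial.map_map, hfm, Polynomial.map_mul, map_C]
  have hgc : g.contentIdeal = ⊤ := by
    rw [hg, contentIdeal_map_eq_map_contentIdeal, hf, Ideal.map_top]
  have hcL : algebraMap K L c ≠ 0 := by simpa using hc
  have hgs : (g.map (algebraMap (𝓞 L) L)).Splits := by
    rw [hgm]
    exact (Splits.C _).mul hL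
  have h0 : ((g.coeff 0 : 𝓞 L) : L) = algebraMap K L (f.coeff 0 : K) := by
    rw [hg, coeff_map]; rfl
  have h1 : ((g.leadingCoeff : 𝓞 L) : L) = algebraMap K L (f.leadingCoeff : K) := by
    rw [hg, leadingCoeff_map_of_injective hinj]; rfl
  have hle := prod_infinitePlace_max_le_prod_mulHeight₁_roots hgc hgs
  have key := prod_infinitePlace_comap_pow_mult (L := L)
    fun v : InfinitePlace K ↦ max (v (f.coeff 0 : K)) (v (f.leadingCoeff : K))
  simp only [InfinitePlace.comap_apply] at key
  simp only [h0, h1] at hle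
  rw [key] at hle
  have hroots : ((g.map (algebraMap (𝓞 L) L)).roots.map mulHeight₁).prod =
      (absMulHeight₁ x ^ finrank ℚ L) ^ finrank K K⟮x⟯ := by
    rw [Multiset.map_congr rfl (g := fun _ ↦ absMulHeight₁ x ^ finrank ℚ L), Multiset.map_const',
      Multiset.prod_replicate, ← hgs.natDegree_eq_card_roots, hgm, natDegree_C_mul hcL,
      natDegree_map, IntermediateField.adjoin.finrank hxK]
    intro r hr
    rw [hgm, roots_C_mul _ hcL] at hr
    refine (absMulHeight₁_pow_finrank hx ?_).symm
    have hr' : aeval r (minpoly K x) = 0 := (mem_aroots.mp hr).2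
    -- Conjugates over `K` are conjugates over ℚ, so all roots have the height of `x`.
    have hd := aeval_eq_zero_of_dvd_aeval_eq_zero
      (minpoly.dvd_map_of_isScalarTower ℚ K x) hr'
    rwa [aeval_map_algebraMap] at hd
  have hpos : 0 < ∏ v : InfinitePlace K,
      max (v (f.coeff 0 : K)) (v (f.leadingCoeff : K)) ^ v.mult := by
    refine Finset.prod_pos fun v _ ↦ pow_pos (lt_max_of_lt_right ?_) _
    rw [InfinitePlace.pos_iff]
    simpa using hf0
  have hlog := Real.log_le_log (pow_pos hpos _) (hle.trans_eq hroots)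
  rw [Real.log_pow, Real.log_pow, Real.log_pow, ← finrank_mul_finrank ℚ K L] at hlog
  have : Module.Finite K L := Module.Finite.of_restrictScalars_finite ℚ K L
  have hKL : (0 : ℝ) < finrank K L := by exact_mod_cast finrank_pos
  refine le_of_mul_le_mul_left (hlog.trans_eq ?_) hKL
  rw [mahlerMeasureOver, absLogHeight₁]
  push_cast
  ring

lemma log_prod_max_le {x : Ω} (hx : IsIntegral ℚ x) {f : (𝓞 K)[X]} {c : K}
    (hc : c ≠ 0) (hf : f.contentIdeal = ⊤)
    (hfm : f.map (algebraMap (𝓞 K) K) = C c * minpoly K x) :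
    Real.log (∏ v : InfinitePlace K, max (v (f.coeff 0 : K)) (v (f.leadingCoeff : K)) ^ v.mult) ≤
      finrank ℚ K * mahlerMeasureOver K x := by
  have : NumberField (minpoly K x).SplittingField := NumberField.of_module_finite K _
  exact log_prod_max_le_of_splits hx (SplittingField.splits (minpoly K x)) hc hf hfm

/-- Integral numerator and denominator of an algebraic number over `K`, bounded in terms of its
Mahler measure. -/
theorem exists_isIntegral_smul_and_log_prod_max_le [IsPrincipalIdealRing (𝓞 K)] {x : Ω}
    (hx : IsIntegral ℚ x) (hx0 : x ≠ 0) :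
    ∃ b c : 𝓞 K, b ≠ 0 ∧ c ≠ 0 ∧ IsIntegral (𝓞 K) (algebraMap K Ω b * x⁻¹) ∧
      IsIntegral (𝓞 K) (algebraMap K Ω c * x) ∧
      Real.log (∏ v : InfinitePlace K, max (v (b : K)) (v (c : K)) ^ v.mult) ≤
        finrank ℚ K * mahlerMeasureOver K x := by
  have hxK : IsIntegral K x := hx.tower_top
  obtain ⟨f, c, hc, hf, hfm⟩ := exists_contentIdeal_eq_top_map_eq_C_mul (R := 𝓞 K)
    (minpoly.ne_zero hxK)
  have hinj : Function.Injective (algebraMap (𝓞 K) K) := RingOfIntegers.coe_injective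
  have hf0 : f ≠ 0 := by
    rintro rfl
    simp at hf
  have haeval : aeval x f = 0 := by
    rw [← aeval_map_algebraMap K, hfm, map_mul, minpoly.aeval, mul_zero]
  have hcoeff : f.coeff 0 ≠ 0 := by
    intro h
    have h' := congrArg (fun p ↦ coeff p 0) hfm
    simp only [coeff_map, h, map_zero, coeff_C_mul] at h'
    exact minpoly.coeff_zero_ne_zero hxK hx0 ((mul_eq_zero.mp h'.symm).resolve_left hc)
  have hsmul (y : 𝓞 K) (z : Ω) : y • z = algebraMap K Ω y * z := by
    rw [Algebra.smul_def, IsScalarTower.algebraMap_apply (𝓞 K) K Ω]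
  refine ⟨f.coeff 0, f.leadingCoeff, hcoeff, by simpa using hf0, ?_, ?_, log_prod_max_le hx hc hf hfm⟩
  · let _ : Invertible x := invertibleOfNonzero hx0
    -- The reversed polynomial has root `x⁻¹` and leading coefficient `f.coeff 0`.
    have h : aeval (⅟x) f.reverse = 0 := (eval₂_reverse_eq_zero_iff _ x f).mpr haeval
    have h' := isIntegral_leadingCoeff_smul f.reverse _ h
    rwa [reverse_leadingCoeff, trailingCoeff_eq_coeff_zero hcoeff, hsmul, invOf_eq_inv] at h'
  · rw [← hsmul]
    exact isIntegral_leadingCoeff_smul f x haeval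

lemma finrank_mul_mahlerMeasureOver_algebraMap (x : K) :
    finrank ℚ K * mahlerMeasureOver K (algebraMap K Ω x) = logHeight₁ x := by
  have hx : IsIntegral ℚ (algebraMap K Ω x) := (IsIntegral.of_finite ℚ x).algebraMap
  have h1 : finrank K K⟮algebraMap K Ω x⟯ = 1 :=
    IntermediateField.finrank_adjoin_simple_eq_one_iff.mpr
      (IntermediateField.mem_bot.mpr ⟨x, rfl⟩)
  rw [mahlerMeasureOver, h1, Nat.cast_one, one_mul]
  refine finrank_mul_absLogHeight₁ hx ?_
  rw [minpoly.algebraMap_eq (algebraMap K Ω).injective, minpoly.aeval]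

lemma logHeight₁_div_le (a b : 𝓞 K) (hb : b ≠ 0) :
    logHeight₁ ((a : K) / b) ≤
      Real.log (∏ v : InfinitePlace K, max (v (a : K)) (v (b : K)) ^ v.mult) := by
  have hn : (Ideal.span {a, b}).absNorm ≠ 0 := by
    rw [Ne, Ideal.absNorm_eq_zero_iff, Ideal.span_eq_bot]
    simp [hb]
  rw [logHeight₁_eq_log_mulHeight₁, ← mulHeight₁_div_mul_absNorm a b hb]
  refine Real.log_le_log (mulHeight₁_pos _) (le_mul_of_one_le_right (mulHeight₁_nonneg _) ?_)
  exact_mod_cast Nat.one_le_iff_ne_zero.mpr hn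

lemma exists_unit_mul_le_of_dvd (hbal : IsBalanced K) {d b : 𝓞 K} (hb : b ≠ 0) (hd : d ∣ b) :
    ∃ u : (𝓞 K)ˣ, ∀ v : InfinitePlace K, v ((u * d : 𝓞 K) : K) ≤ v (b : K) := by
  obtain ⟨q, rfl⟩ := hd
  -- Balancing is applied to the cofactor: enlarging `q` by `u` shrinks `d` by `u⁻¹`, with product
  -- unchanged.
  obtain ⟨u, hu⟩ := hbal q (right_ne_zero_of_mul hb)
  refine ⟨u⁻¹, fun v ↦ ?_⟩
  have h : ((d * q : 𝓞 K) : K) = ((↑u⁻¹ * d : 𝓞 K) : K) * ((u : K) * (q : K)) := by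
    have h' : d * q = (↑u⁻¹ * d) * (↑u * q) := by
      rw [mul_mul_mul_comm, Units.inv_mul, one_mul]
    rw [h']; simp
  rw [h, map_mul]
  exact le_mul_of_one_le_right (apply_nonneg _ _) (hu v)

omit [CharZero Ω] in
-- As `𝓞 K` is integrally closed, `c * A / B` lies in it, so `B ∣ c * A`, and coprimality removes
-- `A`.
lemma dvd_of_isIntegral_div {A B c : 𝓞 K} (hB : B ≠ 0) (hAB : IsRelPrime B A)
    [DecompositionMonoid (𝓞 K)]
    (h : IsIntegral (𝓞 K) (algebraMap K Ω (c * (A / B)))) : B ∣ c := by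
  rw [isIntegral_algebraMap_iff (algebraMap K Ω).injective] at h
  obtain ⟨y, hy⟩ := IsIntegrallyClosed.isIntegral_iff.mp h
  refine hAB.dvd_of_dvd_mul_right ⟨y, ?_⟩
  have hB' : (B : K) ≠ 0 := by simpa using hB
  apply RingOfIntegers.coe_injective
  rw [map_mul, map_mul, hy]
  field_simp

end NumberField

/-! ### The factorization over `K`. -/

theorem corollary1p2 {K : Type*} [Field K] [NumberField K]
    {Qbar : Type*} [Field Qbar] [CharZero Qbar] [IsAlgClosure ℚ Qbar] [Algebra K Qbar]
    (hbal : IsBalanced K) (hcl : NumberField.classNumber K = 1)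
    (α : K) (hα : α ≠ 0) (N : ℕ) (a : Fin N → Qbar)
    (hprod : algebraMap K Qbar α = ∏ n, a n) :
    ∃ γ : Fin (N + 1) → K,
      α = ∏ i, γ i ∧
      (∃ u : (𝓞 K)ˣ, (u : K) = γ 0) ∧
      ∀ n : Fin N,
        mahlerMeasureOver K (algebraMap K Qbar (γ n.succ)) ≤ mahlerMeasureOver K (a n) := by
  have : IsPrincipalIdealRing (𝓞 K) := classNumber_eq_one_iff.mp hcl
  have halg : Algebra.IsAlgebraic ℚ Qbar := IsAlgClosure.isAlgebraic
  have hint (n : Fin N) : IsIntegral ℚ (a n) := (halg.isAlgebraic _).isIntegral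
  have hα' : algebraMap K Qbar α ≠ 0 := by simpa using hα
  have ha (n : Fin N) : a n ≠ 0 := fun h ↦
    hα' (hprod.trans (Finset.prod_eq_zero (Finset.mem_univ n) h))
  choose b c hb hc hbint hcint hbound using fun n ↦
    exists_isIntegral_smul_and_log_prod_max_le (K := K) (hint n) (ha n)
  obtain ⟨A, B, hrel, hmk⟩ := IsFractionRing.exists_reduced_fraction (𝓞 K) α
  have hB : (B : 𝓞 K) ≠ 0 := nonZeroDivisors.ne_zero B.2
  rw [IsFractionRing.mk'_eq_div] at hmk
  have hA : A ≠ 0 := by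
    rintro rfl
    exact hα (by simp [← hmk])
  have hBdvd : (B : 𝓞 K) ∣ ∏ n, c n := by
    refine dvd_of_isIntegral_div (Ω := Qbar) hB hrel.symm ?_
    have h : algebraMap K Qbar (((∏ n, c n : 𝓞 K) : K) * ((A : K) / ((B : 𝓞 K) : K))) =
        ∏ n, (algebraMap K Qbar (c n) * a n) := by
      simp only [RingOfIntegers.coe_eq_algebraMap]
      rw [Finset.prod_mul_distrib, ← hprod, map_mul, hmk, map_prod (algebraMap (𝓞 K) K),
        map_prod]
    rw [h]
    exact IsIntegral.prod _ fun n _ ↦ hcint n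
  have hAdvd : A ∣ ∏ n, b n := by
    refine dvd_of_isIntegral_div (Ω := Qbar) hA hrel ?_
    have h : algebraMap K Qbar (((∏ n, b n : 𝓞 K) : K) * (((B : 𝓞 K) : K) / (A : K))) =
        ∏ n, (algebraMap K Qbar (b n) * (a n)⁻¹) := by
      simp only [RingOfIntegers.coe_eq_algebraMap]
      rw [Finset.prod_mul_distrib, Finset.prod_inv_distrib, ← hprod, map_mul, ← inv_div, hmk,
        map_inv₀, map_prod (algebraMap (𝓞 K) K), map_prod]
    rw [h]
    exact IsIntegral.prod _ fun n _ ↦ hbint n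
  obtain ⟨uA, s, hs, hsb⟩ := Finset.univ.exists_unit_mul_prod_eq_of_dvd_prod hAdvd
  obtain ⟨uB, t, ht, htc⟩ := Finset.univ.exists_unit_mul_prod_eq_of_dvd_prod hBdvd
  choose u hu using fun n ↦ exists_unit_mul_le_of_dvd hbal (hb n) (hsb n (Finset.mem_univ n))
  choose w hw using fun n ↦ exists_unit_mul_le_of_dvd hbal (hc n) (htc n (Finset.mem_univ n))
  have ht0 (n : Fin N) : t n ≠ 0 := ne_zero_of_dvd_ne_zero (hc n) (htc n (Finset.mem_univ n))
  have hwt (n : Fin N) : (w n * t n : 𝓞 K) ≠ 0 := mul_ne_zero (w n).ne_zero (ht0 n)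
  -- This undoes the rescalings by `u` and `w` and restores the units of the factorizations of `A`
  -- and `B`.
  let U : (𝓞 K)ˣ := uA * (∏ n, u n)⁻¹ * (uB * (∏ n, w n)⁻¹)⁻¹
  refine ⟨Fin.cons (U : K) fun n ↦ ((u n * s n : 𝓞 K) : K) / ((w n * t n : 𝓞 K) : K), ?_,
    ⟨U, rfl⟩, fun n ↦ ?_⟩
  · rw [Fin.prod_cons, ← hmk, hs, ht, Finset.prod_div_distrib]
    have hu0 : ∏ n, ((u n : 𝓞 K) : K) ≠ 0 := Finset.prod_ne_zero_iff.mpr fun n _ ↦ by simp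
    have hw0 : ∏ n, ((w n : 𝓞 K) : K) ≠ 0 := Finset.prod_ne_zero_iff.mpr fun n _ ↦ by simp
    have ht0' : ∏ n, (t n : K) ≠ 0 := Finset.prod_ne_zero_iff.mpr fun n _ ↦ by simpa using ht0 n
    have huB : ((uB : 𝓞 K) : K) ≠ 0 := by simp
    have hU : ((U : 𝓞 K) : K) = (uA : 𝓞 K) * (∏ n, ((u n : 𝓞 K) : K))⁻¹ *
        ((uB : 𝓞 K) * (∏ n, ((w n : 𝓞 K) : K))⁻¹)⁻¹ := by
      simp [U]
    rw [show algebraMap (𝓞 K) K U = ((U : 𝓞 K) : K) from rfl, hU]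
    simp only [RingOfIntegers.coe_eq_algebraMap] at hu0 hw0 ht0' huB ⊢
    simp only [map_mul, map_prod, Finset.prod_mul_distrib]
    field_simp
  · have hd : (0 : ℝ) < Module.finrank ℚ K := by exact_mod_cast Module.finrank_pos
    refine le_of_mul_le_mul_left (le_trans ?_ (hbound n)) hd
    rw [finrank_mul_mahlerMeasureOver_algebraMap, Fin.cons_succ]
    refine (logHeight₁_div_le _ _ (hwt n)).trans (Real.log_le_log ?_ ?_)
    · refine Finset.prod_pos fun v _ ↦ pow_pos (lt_max_of_lt_right ?_) _
      rw [InfinitePlace.pos_iff]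
      simpa using hwt n
    · exact Finset.prod_le_prod
        (fun v _ ↦ pow_nonneg ((apply_nonneg v _).trans (le_max_left _ _)) _) fun v _ ↦
        pow_le_pow_left₀ ((apply_nonneg v _).trans (le_max_left _ _)) (max_le_max (hu n v) (hw n v)) _
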